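/- Let $A$ be a set of atomic types (for instance a denumerable one), ranged over by $\varphi$, and let $\omega\notin A$. Types are given by $$\sigma ::= \varphi \mid \omega \mid \sigma\to\sigma \mid \sigma\wedge\sigma \mid \sigma\vee\sigma ,$$ where $\wedge$ and $\vee$ bind more tightly than $\to$. Let $\le$ be the least pre-order on types such that, for all types and all $\varphi\in A$, $$\sigma\le\omega,\quad \sigma\wedge\tau\le\sigma,\quad \sigma\wedge\tau\le\tau,\quad \sigma\le\sigma\vee\tau,\quad \tau\le\sigma\vee\tau,\quad \varphi\le\sigma\to\varphi,\quad \omega\le\sigma\to\omega,$$ $$\sigma\le\tau,\ \sigma\le\rho\Rightarrow\sigma\le\tau\wedge\rho;\qquad \sigma\le\tau,\ \rho\le\tau\Rightarrow\sigma\vee\rho\le\tau;\qquad \sigma'\le\sigma,\ \tau\le\tau'\Rightarrow\sigma\to\tau\le\sigma'\to\tau'.$$ The inner rules $\rightsquigarrow$ are: \begin{itemize} \item $\omega\to\varphi\rightsquigarrow\varphi$ for $\varphi\in A$; \item $\sigma\rightsquigarrow\omega$ if $\omega\le\sigma$ and $\sigma\neq\omega$; \item $\sigma\to\tau\wedge\rho\rightsquigarrow(\sigma\to\tau)\wedge(\sigma\to\rho)$;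 \item $\sigma\vee\tau\to\rho\rightsquigarrow(\sigma\to\rho)\wedge(\tau\to\rho)$; \item $(\sigma\vee\tau)\wedge\rho\to\zeta\rightsquigarrow(\sigma\wedge\rho)\vee(\tau\wedge\rho)\to\zeta$; \item $\sigma\to(\tau\wedge\rho)\vee\zeta\rightsquigarrow\sigma\to(\tau\vee\zeta)\wedge(\rho\vee\zeta)$; \item $\sigma\wedge\tau\rightsquigarrow\sigma$ and $\sigma\vee\tau\rightsquigarrow\tau$ if $\sigma\le\tau$. \end{itemize} A type context $\mathcal C[\,]$ is a type with exactly one hole; its hole is at top level if it does not lie inside an arrow. The top rules are: $\mathcal C[\sigma]\Longrightarrow\mathcal C[\tau]$ for every context $\mathcal C[\,]$ whenever $\sigma\rightsquigarrow\tau$; and $\mathcal C[(\sigma\wedge\tau)\vee\rho]\Longrightarrow\mathcal C[(\sigma\vee\rho)\wedge(\tau\vee\rho)]$ for every context $\mathcal C[\,]$ whose hole is at top level. Let $=_{AC}$ be the least congruence on types that makes $\wedge$ and $\vee$ associative and commutative. On $=_{AC}$-classes write $p\Longrightarrow q$ if $\sigma\Longrightarrow\tau$ for some $\sigma\in p$ and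 $\tau\in q$. \textbf{Theorem (Uniqueness of normal form).} The relation $\Longrightarrow$ on types modulo associativity and commutativity is terminating (there is no infinite sequence $p_0\Longrightarrow p_1\Longrightarrow\cdots$) and confluent (if $p\Longrightarrow^*q$ and $p\Longrightarrow^*r$, then $q\Longrightarrow^*u$ and $r\Longrightarrow^*u$ for some $u$). Consequently every type has exactly one normal form modulo associativity and commutativity: for every type $\sigma$ there is exactly one class $n$ such that the class of $\sigma$ reduces to $n$ by $\Longrightarrow^*$ and no step $n\Longrightarrow q$ exists. -/

import Mathlib

namespace IUType

/-- Intersection and union types over a set `A` of atomic types; the constant `omega` is not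
one of the atoms. -/
inductive Ty (A : Type*) where
  | atom (a : A) : Ty A
  | omega : Ty A
  | arr (s t : Ty A) : Ty A
  | inf (s t : Ty A) : Ty A
  | sup (s t : Ty A) : Ty A

infixr:60 " ⟶ₜ " => Ty.arr
infixl:70 " ∧ₜ " => Ty.inf
infixl:70 " ∨ₜ " => Ty.sup

/-- The normalisation pre-order: the least pre-order closed under the clauses below. -/
inductive NLe {A : Type*} : Ty A → Ty A → Prop
  | refl (s : Ty A) : NLe s s
  | trans {s t r : Ty A} : NLe s t → NLe t r → NLe s r
  | le_omega (s : Ty A) : NLe s Ty.omega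
  | inf_left (s t : Ty A) : NLe (s ∧ₜ t) s
  | inf_right (s t : Ty A) : NLe (s ∧ₜ t) t
  | sup_left (s t : Ty A) : NLe s (s ∨ₜ t)
  | sup_right (s t : Ty A) : NLe t (s ∨ₜ t)
  | le_inf {s t r : Ty A} : NLe s t → NLe s r → NLe s (t ∧ₜ r)
  | sup_le {s t r : Ty A} : NLe s t → NLe r t → NLe (s ∨ₜ r) t
  | atom_arr (a : A) (s : Ty A) : NLe (Ty.atom a) (s ⟶ₜ Ty.atom a)
  | omega_arr (s : Ty A) : NLe Ty.omega (s ⟶ₜ Ty.omega)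
  | arr_mono {s s' t t' : Ty A} : NLe s' s → NLe t t' → NLe (s ⟶ₜ t) (s' ⟶ₜ t')

/-- The inner normalisation rules, applied at the root of a type. -/
inductive Inner {A : Type*} : Ty A → Ty A → Prop
  | atom (a : A) : Inner (Ty.omega ⟶ₜ Ty.atom a) (Ty.atom a)
  | omega {s : Ty A} : NLe Ty.omega s → s ≠ Ty.omega → Inner s Ty.omega
  | arr_inf (s t r : Ty A) : Inner (s ⟶ₜ t ∧ₜ r) ((s ⟶ₜ t) ∧ₜ (s ⟶ₜ r))
  | sup_arr (s t r : Ty A) : Inner (s ∨ₜ t ⟶ₜ r) ((s ⟶ₜ r) ∧ₜ (t ⟶ₜ r))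
  | dist_left (s t r z : Ty A) :
      Inner ((s ∨ₜ t) ∧ₜ r ⟶ₜ z) ((s ∧ₜ r) ∨ₜ (t ∧ₜ r) ⟶ₜ z)
  | dist_right (s t r z : Ty A) :
      Inner (s ⟶ₜ (t ∧ₜ r) ∨ₜ z) (s ⟶ₜ (t ∨ₜ z) ∧ₜ (r ∨ₜ z))
  | erase_inf {s t : Ty A} : NLe s t → Inner (s ∧ₜ t) s
  | erase_sup {s t : Ty A} : NLe s t → Inner (s ∨ₜ t) t

/-- Type contexts with exactly one hole. -/
inductive Ctx (A : Type*) where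
  | hole : Ctx A
  | arrLeft (C : Ctx A) (s : Ty A) : Ctx A
  | arrRight (s : Ty A) (C : Ctx A) : Ctx A
  | infLeft (C : Ctx A) (s : Ty A) : Ctx A
  | infRight (s : Ty A) (C : Ctx A) : Ctx A
  | supLeft (C : Ctx A) (s : Ty A) : Ctx A
  | supRight (s : Ty A) (C : Ctx A) : Ctx A

/-- `C.fill u` replaces the hole of `C` by `u`. -/
def Ctx.fill {A : Type*} : Ctx A → Ty A → Ty A
  | .hole, u => u
  | .arrLeft C s, u => C.fill u ⟶ₜ s
  | .arrRight s C, u => s ⟶ₜ C.fill u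
  | .infLeft C s, u => C.fill u ∧ₜ s
  | .infRight s C, u => s ∧ₜ C.fill u
  | .supLeft C s, u => C.fill u ∨ₜ s
  | .supRight s C, u => s ∨ₜ C.fill u

/-- The hole of the context is at top level, that is, not inside an arrow. -/
def Ctx.TopLevel {A : Type*} : Ctx A → Prop
  | .hole => True
  | .arrLeft _ _ => False
  | .arrRight _ _ => False
  | .infLeft C _ => C.TopLevel
  | .infRight _ C => C.TopLevel
  | .supLeft C _ => C.TopLevel
  | .supRight _ C => C.TopLevel

/-- The top normalisation rules: the inner rules in every context, and the distribution of
union over intersection at top level. -/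
inductive Top {A : Type*} : Ty A → Ty A → Prop
  | ctx (C : Ctx A) {s t : Ty A} : Inner s t → Top (C.fill s) (C.fill t)
  | dist (C : Ctx A) (s t r : Ty A) : C.TopLevel →
      Top (C.fill ((s ∧ₜ t) ∨ₜ r)) (C.fill ((s ∨ₜ r) ∧ₜ (t ∨ₜ r)))

/-- Equality modulo associativity and commutativity of intersection and of union: the least
congruence containing these four laws. -/
inductive ACEq {A : Type*} : Ty A → Ty A → Prop
  | refl (s : Ty A) : ACEq s s
  | symm {s t : Ty A} : ACEq s t → ACEq t s
  | trans {s t r : Ty A} : ACEq s t → ACEq t r → ACEq s r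
  | inf_comm (s t : Ty A) : ACEq (s ∧ₜ t) (t ∧ₜ s)
  | inf_assoc (s t r : Ty A) : ACEq ((s ∧ₜ t) ∧ₜ r) (s ∧ₜ (t ∧ₜ r))
  | sup_comm (s t : Ty A) : ACEq (s ∨ₜ t) (t ∨ₜ s)
  | sup_assoc (s t r : Ty A) : ACEq ((s ∨ₜ t) ∨ₜ r) (s ∨ₜ (t ∨ₜ r))
  | arr {s s' t t' : Ty A} : ACEq s s' → ACEq t t' → ACEq (s ⟶ₜ t) (s' ⟶ₜ t')
  | inf {s s' t t' : Ty A} : ACEq s s' → ACEq t t' → ACEq (s ∧ₜ t) (s' ∧ₜ t')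
  | sup {s s' t t' : Ty A} : ACEq s s' → ACEq t t' → ACEq (s ∨ₜ t) (s' ∨ₜ t')

def acSetoid (A : Type*) : Setoid (Ty A) where
  r := ACEq
  iseqv := ⟨ACEq.refl, ACEq.symm, ACEq.trans⟩

/-- Types modulo associativity and commutativity. -/
def TyAC (A : Type*) : Type _ := Quotient (acSetoid A)

/-- The class of a type. -/
def TyAC.mk {A : Type*} (s : Ty A) : TyAC A := Quotient.mk (acSetoid A) s

/-- One step of top normalisation on types modulo associativity and commutativity: some
representative of the first class reduces to some representative of the second. -/
def Step {A : Type*} (p q : TyAC A) : Prop :=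
  ∃ s t : Ty A, TyAC.mk s = p ∧ TyAC.mk t = q ∧ Top s t

/-- Finitely many (possibly zero) steps. -/
def Steps {A : Type*} : TyAC A → TyAC A → Prop := Relation.ReflTransGen Step

/-- There is no infinite sequence of steps. -/
def Terminating (A : Type*) : Prop := WellFounded fun q p : TyAC A => Step p q

/-- Any two reducts of a common class have a common reduct. -/
def Confluent (A : Type*) : Prop :=
  ∀ p q r : TyAC A, Steps p q → Steps p r → ∃ u, Steps q u ∧ Steps r u

/-- No step is possible. -/
def IsNormal {A : Type*} (p : TyAC A) : Prop := ∀ q, ¬ Step p q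

end IUType

/-!
Termination is shown by a weight. A type is read in one of two modes: at top level and to the right
of an arrow only unions are distributed over intersections, to the left of an arrow only
intersections are distributed over unions. In each mode the connective being distributed is
interpreted by a product and the other one by a sum, while an arrow is interpreted by an
exponential, so that it outweighs the two arrows into which it may split (`Top.wt_lt`).

Confluence and uniqueness follow from termination once equivalent normal types are known to be
equal. Equivalence is given by an invariant. Every type has a conjunctive form `cnf` and a
disjunctive form `dnf`, built from *prime types*: atoms, and arrows from an intersection of prime
types to a union of prime types. Prime types carry an explicit order `PLe`, in which `a` and `ω → a`
are equivalent for every atom `a`; it induces an order on types through each of the two forms. Both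
induced orders contain the normalisation pre-order (`NLe.rLe_and_lLe`). The inner rules preserve
both forms up to equivalence, and distribution at top level preserves the conjunctive one
(`Top.rLe`).

Conversely, a normal type is an intersection of unions of atoms and arrows, and each such arrow goes
from an intersection to a nonempty union of atoms and arrows, because any other shape admits a
distribution, a splitting or an erasure modulo associativity and commutativity. Hence each atom or
arrow that occurs denotes a single prime type. Since `ω → a` is not normal, `PLe` between such
members already implies `NLe` (`NBase.nLe_of_rLe`), so the absence of erasures makes the members of
each intersection and union pairwise incomparable. Two lists of pairwise incomparable members that
dominate each other agree up to order (`ACOp.big_acEq_of_rel`), and induction on the size shows that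
equivalent normal types are equal modulo associativity and commutativity (`IsNormal.acEq`).
-/

namespace IUType

variable {A : Type*}

/-! ### Prime types and their order -/

/-- Prime types: an atom, or an arrow from an intersection of prime types to a union of prime
types. Both are given by lists of their members; the empty intersection is `ω`. -/
inductive PTy (A : Type*) where
  | atom (a : A) : PTy A
  | arr (l r : List (PTy A)) : PTy A

instance : Inhabited (PTy A) := ⟨.arr [] []⟩

/-- The order on prime types, in which an atom `a` is equivalent to `ω → a`. In the last clause
`f` and `g` select witnesses: every member of `l` lies above a member of `l'`, and every member of
`r` lies below a member of `r'`. -/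
inductive PLe : PTy A → PTy A → Prop
  | atom (a : A) : PLe (.atom a) (.atom a)
  | atom_arr {a : A} {b : PTy A} {l r : List (PTy A)} :
      b ∈ r → PLe (.atom a) b → PLe (.atom a) (.arr l r)
  | arr_atom {a : A} {r : List (PTy A)} :
      (∀ b ∈ r, PLe b (.atom a)) → PLe (.arr [] r) (.atom a)
  | arr {l r l' r' : List (PTy A)} (f g : PTy A → PTy A) :
      (∀ x ∈ l, f x ∈ l') → (∀ x ∈ l, PLe (f x) x) →
      (∀ y ∈ r, g y ∈ r') → (∀ y ∈ r, PLe y (g y)) → PLe (.arr l r) (.arr l' r')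

/-- The order on lists of prime types read as unions. -/
def UnionLe (C D : List (PTy A)) : Prop := ∀ p ∈ C, ∃ q ∈ D, PLe p q

/-- The order on lists of prime types read as intersections. -/
def InterLe (C D : List (PTy A)) : Prop := ∀ q ∈ D, ∃ p ∈ C, PLe p q

theorem pLe_arr_arr {l r l' r' : List (PTy A)} :
    PLe (.arr l r) (.arr l' r') ↔ InterLe l' l ∧ UnionLe r r' := by
  constructor
  · rintro (_ | _ | _ | ⟨f, g, h₁, h₂, h₃, h₄⟩)
    exact ⟨fun x hx => ⟨f x, h₁ x hx, h₂ x hx⟩, fun y hy => ⟨g y, h₃ y hy, h₄ y hy⟩⟩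
  · rintro ⟨h₁, h₂⟩
    choose! f hf using h₁
    choose! g hg using h₂
    exact .arr f g (fun x hx => (hf x hx).1) (fun x hx => (hf x hx).2)
      (fun y hy => (hg y hy).1) (fun y hy => (hg y hy).2)

theorem PLe.refl : ∀ p : PTy A, PLe p p
  | .atom a => .atom a
  | .arr l r => .arr id id (fun _ h => h) (fun x _ => PLe.refl x) (fun _ h => h)
      (fun y _ => PLe.refl y)

theorem PLe.trans {p q r : PTy A} (h₁ : PLe p q) (h₂ : PLe q r) : PLe p r := by
  -- Induction on the total size, because arrows exchange the roles of `p` and `r` on the left.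
  induction hn : sizeOf p + sizeOf q + sizeOf r using Nat.strong_induction_on
    generalizing p q r with
  | _ n ih =>
    subst hn
    cases h₁ with
    | atom a => exact h₂
    | @atom_arr a b l m hb hab =>
      have hs := List.sizeOf_lt_of_mem hb
      cases h₂ with
      | arr_atom h => exact ih _ (by simp; omega) hab (h b hb) rfl
      | @arr _ _ l' m' f g _ _ hg hg' =>
        have hs' := List.sizeOf_lt_of_mem (hg b hb)
        exact .atom_arr (hg b hb) (ih _ (by simp; omega) hab (hg' b hb) rfl)
    | @arr_atom a m h =>
      cases h₂ with
      | atom => exact .arr_atom h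
      | @atom_arr _ b l' m' hb hab =>
        refine pLe_arr_arr.2 ⟨by simp [InterLe], fun y hy => ⟨b, hb, ?_⟩⟩
        have hs := List.sizeOf_lt_of_mem hb
        have hs' := List.sizeOf_lt_of_mem hy
        exact ih _ (by simp; omega) (h y hy) hab rfl
    | @arr l m l' m' f g hf hf' hg hg' =>
      cases h₂ with
      | arr_atom h =>
        have hl : l = [] := List.eq_nil_iff_forall_not_mem.2 fun x hx => by simpa using hf x hx
        subst hl
        refine .arr_atom fun y hy => ?_
        have hs := List.sizeOf_lt_of_mem hy
        have hs' := List.sizeOf_lt_of_mem (hg y hy)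
        exact ih _ (by simp; omega) (hg' y hy) (h _ (hg y hy)) rfl
      | @arr _ _ l'' m'' f' g' kf kf' kg kg' =>
        refine .arr (f' ∘ f) (g' ∘ g) (fun x hx => kf _ (hf x hx)) (fun x hx => ?_)
          (fun y hy => kg _ (hg y hy)) (fun y hy => ?_)
        · have hs := List.sizeOf_lt_of_mem hx
          have hs' := List.sizeOf_lt_of_mem (hf x hx)
          have hs'' := List.sizeOf_lt_of_mem (kf _ (hf x hx))
          exact ih _ (by simp; omega) (kf' _ (hf x hx)) (hf' x hx) rfl
        · have hs := List.sizeOf_lt_of_mem hy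
          have hs' := List.sizeOf_lt_of_mem (hg y hy)
          have hs'' := List.sizeOf_lt_of_mem (kg _ (hg y hy))
          exact ih _ (by simp; omega) (hg' y hy) (kg' _ (hg y hy)) rfl

theorem UnionLe.refl (C : List (PTy A)) : UnionLe C C := fun p hp => ⟨p, hp, PLe.refl p⟩

theorem InterLe.refl (C : List (PTy A)) : InterLe C C := fun p hp => ⟨p, hp, PLe.refl p⟩

theorem UnionLe.trans {C D E : List (PTy A)} (h₁ : UnionLe C D) (h₂ : UnionLe D E) :
    UnionLe C E := fun p hp =>
  let ⟨q, hq, hpq⟩ := h₁ p hp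
  let ⟨r, hr, hqr⟩ := h₂ q hq
  ⟨r, hr, hpq.trans hqr⟩

theorem InterLe.trans {C D E : List (PTy A)} (h₁ : InterLe C D) (h₂ : InterLe D E) :
    InterLe C E := fun r hr =>
  let ⟨q, hq, hqr⟩ := h₂ r hr
  let ⟨p, hp, hpq⟩ := h₁ q hq
  ⟨p, hp, hpq.trans hqr⟩

/-! ### Conjunctive and disjunctive forms of types -/

mutual

/-- The conjunctive form of a type: the list of the members of an intersection, each of which is
the list of the members of a union of prime types. An arrow becomes the intersection of the prime
arrows from a member of the disjunctive form of its source to a member of the conjunctive form of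
its target. -/
def cnf : Ty A → List (List (PTy A))
  | .atom a => [[.atom a]]
  | .omega => []
  | .arr s t => ((dnf s).flatMap fun l => (cnf t).map fun r => .arr l r).map fun p => [p]
  | .inf s t => cnf s ++ cnf t
  | .sup s t => (cnf s).flatMap fun C => (cnf t).map fun D => C ++ D

/-- The disjunctive form of a type: the list of the members of a union, each of which is the list
of the members of an intersection of prime types. -/
def dnf : Ty A → List (List (PTy A))
  | .atom a => [[.atom a]]
  | .omega => [[]]
  | .arr s t => [(dnf s).flatMap fun l => (cnf t).map fun r => .arr l r]
  | .inf s t => (dnf s).flatMap fun C => (dnf t).map fun D => C ++ D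
  | .sup s t => dnf s ++ dnf t

end

/-- The order on types induced by their conjunctive forms. It decides how types compare at top
level and to the right of an arrow. -/
def RLe (s t : Ty A) : Prop := ∀ D ∈ cnf t, ∃ C ∈ cnf s, UnionLe C D

/-- The order on types induced by their disjunctive forms. It decides how types compare to the
left of an arrow. -/
def LLe (s t : Ty A) : Prop := ∀ C ∈ dnf s, ∃ D ∈ dnf t, InterLe C D

theorem RLe.refl (s : Ty A) : RLe s s := fun D hD => ⟨D, hD, UnionLe.refl D⟩

theorem LLe.refl (s : Ty A) : LLe s s := fun D hD => ⟨D, hD, InterLe.refl D⟩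

theorem RLe.trans {s t r : Ty A} (h₁ : RLe s t) (h₂ : RLe t r) : RLe s r := fun E hE =>
  let ⟨D, hD, hDE⟩ := h₂ E hE
  let ⟨C, hC, hCD⟩ := h₁ D hD
  ⟨C, hC, hCD.trans hDE⟩

theorem LLe.trans {s t r : Ty A} (h₁ : LLe s t) (h₂ : LLe t r) : LLe s r := fun C hC =>
  let ⟨D, hD, hCD⟩ := h₁ C hC
  let ⟨E, hE, hDE⟩ := h₂ D hD
  ⟨E, hE, hCD.trans hDE⟩

theorem rLe_arr {s s' t t' : Ty A} (hs : LLe s' s) (ht : RLe t t') :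
    RLe (s ⟶ₜ t) (s' ⟶ₜ t') := by
  intro D hD
  simp only [cnf, List.mem_map, List.mem_flatMap] at hD
  obtain ⟨_, ⟨l', hl', r', hr', rfl⟩, rfl⟩ := hD
  obtain ⟨l, hl, hll⟩ := hs l' hl'
  obtain ⟨r, hr, hrr⟩ := ht r' hr'
  refine ⟨[.arr l r], ?_, ?_⟩
  · simp only [cnf, List.mem_map, List.mem_flatMap]
    exact ⟨_, ⟨l, hl, r, hr, rfl⟩, rfl⟩
  · simpa [UnionLe] using pLe_arr_arr.2 ⟨hll, hrr⟩

theorem lLe_arr {s s' t t' : Ty A} (hs : LLe s' s) (ht : RLe t t') :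
    LLe (s ⟶ₜ t) (s' ⟶ₜ t') := by
  intro C hC
  simp only [dnf, List.mem_singleton] at hC
  subst hC
  refine ⟨_, List.mem_singleton_self _, ?_⟩
  intro p hp
  simp only [List.mem_map, List.mem_flatMap] at hp
  obtain ⟨l', hl', r', hr', rfl⟩ := hp
  obtain ⟨l, hl, hll⟩ := hs l' hl'
  obtain ⟨r, hr, hrr⟩ := ht r' hr'
  refine ⟨.arr l r, ?_, pLe_arr_arr.2 ⟨hll, hrr⟩⟩
  simp only [List.mem_map, List.mem_flatMap]
  exact ⟨l, hl, r, hr, rfl⟩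

theorem RLe.inf_left (s t : Ty A) : RLe (s ∧ₜ t) s :=
  fun D hD => ⟨D, by simp [cnf, hD], UnionLe.refl D⟩

theorem RLe.inf_right (s t : Ty A) : RLe (s ∧ₜ t) t :=
  fun D hD => ⟨D, by simp [cnf, hD], UnionLe.refl D⟩

theorem LLe.sup_left (s t : Ty A) : LLe s (s ∨ₜ t) :=
  fun D hD => ⟨D, by simp [dnf, hD], InterLe.refl D⟩

theorem LLe.sup_right (s t : Ty A) : LLe t (s ∨ₜ t) :=
  fun D hD => ⟨D, by simp [dnf, hD], InterLe.refl D⟩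

theorem RLe.le_inf {s t r : Ty A} (h₁ : RLe s t) (h₂ : RLe s r) : RLe s (t ∧ₜ r) := by
  intro D hD
  simp only [cnf, List.mem_append] at hD
  exact hD.elim (h₁ D) (h₂ D)

theorem LLe.sup_le {s t r : Ty A} (h₁ : LLe s t) (h₂ : LLe r t) : LLe (s ∨ₜ r) t := by
  intro D hD
  simp only [dnf, List.mem_append] at hD
  exact hD.elim (h₁ D) (h₂ D)

theorem mem_cnf_sup {s t : Ty A} {E : List (PTy A)} :
    E ∈ cnf (s ∨ₜ t) ↔ ∃ C ∈ cnf s, ∃ D ∈ cnf t, C ++ D = E := by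
  simp only [cnf, List.mem_map, List.mem_flatMap]

theorem mem_dnf_inf {s t : Ty A} {E : List (PTy A)} :
    E ∈ dnf (s ∧ₜ t) ↔ ∃ C ∈ dnf s, ∃ D ∈ dnf t, C ++ D = E := by
  simp only [dnf, List.mem_map, List.mem_flatMap]

theorem RLe.sup_left (s t : Ty A) : RLe s (s ∨ₜ t) := by
  intro E hE
  obtain ⟨C, hC, D, hD, rfl⟩ := mem_cnf_sup.1 hE
  exact ⟨C, hC, fun p hp => ⟨p, by simp [hp], PLe.refl p⟩⟩

theorem RLe.sup_right (s t : Ty A) : RLe t (s ∨ₜ t) := by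
  intro E hE
  obtain ⟨C, hC, D, hD, rfl⟩ := mem_cnf_sup.1 hE
  exact ⟨D, hD, fun p hp => ⟨p, by simp [hp], PLe.refl p⟩⟩

theorem LLe.inf_left (s t : Ty A) : LLe (s ∧ₜ t) s := by
  intro E hE
  obtain ⟨C, hC, D, hD, rfl⟩ := mem_dnf_inf.1 hE
  exact ⟨C, hC, fun p hp => ⟨p, by simp [hp], PLe.refl p⟩⟩

theorem LLe.inf_right (s t : Ty A) : LLe (s ∧ₜ t) t := by
  intro E hE
  obtain ⟨C, hC, D, hD, rfl⟩ := mem_dnf_inf.1 hE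
  exact ⟨D, hD, fun p hp => ⟨p, by simp [hp], PLe.refl p⟩⟩

theorem RLe.sup_le {s t r : Ty A} (h₁ : RLe s t) (h₂ : RLe r t) : RLe (s ∨ₜ r) t := by
  intro E hE
  obtain ⟨C, hC, hCE⟩ := h₁ E hE
  obtain ⟨D, hD, hDE⟩ := h₂ E hE
  refine ⟨C ++ D, mem_cnf_sup.2 ⟨C, hC, D, hD, rfl⟩, fun p hp => ?_⟩
  exact (List.mem_append.1 hp).elim (hCE p) (hDE p)

theorem LLe.le_inf {s t r : Ty A} (h₁ : LLe s t) (h₂ : LLe s r) : LLe s (t ∧ₜ r) := by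
  intro E hE
  obtain ⟨C, hC, hCE⟩ := h₁ E hE
  obtain ⟨D, hD, hDE⟩ := h₂ E hE
  refine ⟨C ++ D, mem_dnf_inf.2 ⟨C, hC, D, hD, rfl⟩, fun p hp => ?_⟩
  exact (List.mem_append.1 hp).elim (hCE p) (hDE p)

/-- Both induced orders contain the normalisation pre-order. -/
theorem NLe.rLe_and_lLe {s t : Ty A} (h : NLe s t) : RLe s t ∧ LLe s t := by
  induction h with
  | refl s => exact ⟨.refl s, .refl s⟩
  | trans _ _ h₁ h₂ => exact ⟨h₁.1.trans h₂.1, h₁.2.trans h₂.2⟩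
  | le_omega s => exact ⟨by simp [RLe, cnf], fun C _ => ⟨[], by simp [dnf], by simp [InterLe]⟩⟩
  | inf_left s t => exact ⟨.inf_left s t, .inf_left s t⟩
  | inf_right s t => exact ⟨.inf_right s t, .inf_right s t⟩
  | sup_left s t => exact ⟨.sup_left s t, .sup_left s t⟩
  | sup_right s t => exact ⟨.sup_right s t, .sup_right s t⟩
  | le_inf _ _ h₁ h₂ => exact ⟨h₁.1.le_inf h₂.1, h₁.2.le_inf h₂.2⟩
  | sup_le _ _ h₁ h₂ => exact ⟨h₁.1.sup_le h₂.1, h₁.2.sup_le h₂.2⟩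
  | atom_arr a s =>
    have key (l : List (PTy A)) : PLe (.atom a) (.arr l [.atom a]) :=
      .atom_arr (List.mem_singleton_self _) (.atom a)
    constructor
    · intro D hD
      simp only [cnf, List.mem_map, List.mem_flatMap, List.mem_singleton] at hD
      obtain ⟨_, ⟨l, _, _, rfl, rfl⟩, rfl⟩ := hD
      exact ⟨[.atom a], by simp [cnf], by simpa [UnionLe] using key l⟩
    · intro C hC
      simp only [dnf, List.mem_singleton] at hC
      subst hC
      refine ⟨_, List.mem_singleton_self _, fun p hp => ?_⟩
      simp only [cnf, List.mem_map, List.mem_flatMap, List.mem_singleton] at hp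
      obtain ⟨l, _, _, rfl, rfl⟩ := hp
      exact ⟨.atom a, by simp, key l⟩
  | omega_arr s => exact ⟨by simp [RLe, cnf], by simp [LLe, cnf, dnf, InterLe]⟩
  | arr_mono _ _ h₁ h₂ => exact ⟨rLe_arr h₁.2 h₂.1, lLe_arr h₁.2 h₂.1⟩

theorem not_omega_nLe_atom (a : A) : ¬ NLe Ty.omega (.atom a) := fun h => by
  obtain ⟨C, hC, -⟩ := h.rLe_and_lLe.1 [.atom a] (by simp [cnf])
  simp [cnf] at hC

/-! ### Invariance of the forms under reduction -/

/-- Equivalence for both induced orders. -/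
def BiEq (s t : Ty A) : Prop := (RLe s t ∧ LLe s t) ∧ (RLe t s ∧ LLe t s)

theorem BiEq.of_nLe {s t : Ty A} (h₁ : NLe s t) (h₂ : NLe t s) : BiEq s t :=
  ⟨h₁.rLe_and_lLe, h₂.rLe_and_lLe⟩

theorem LLe.dist (s t r : Ty A) : LLe ((s ∨ₜ t) ∧ₜ r) ((s ∧ₜ r) ∨ₜ (t ∧ₜ r)) := by
  intro E hE
  refine ⟨E, ?_, InterLe.refl E⟩
  simp only [dnf, List.mem_append, List.mem_flatMap] at hE ⊢
  obtain ⟨C, hC | hC, hE⟩ := hE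
  · exact .inl ⟨C, hC, hE⟩
  · exact .inr ⟨C, hC, hE⟩

theorem RLe.dist (s t r : Ty A) : RLe ((s ∨ₜ r) ∧ₜ (t ∨ₜ r)) ((s ∧ₜ t) ∨ₜ r) := by
  intro E hE
  refine ⟨E, ?_, UnionLe.refl E⟩
  simp only [cnf, List.mem_append, List.mem_flatMap] at hE ⊢
  obtain ⟨C, hC | hC, hE⟩ := hE
  · exact .inl ⟨C, hC, hE⟩
  · exact .inr ⟨C, hC, hE⟩

theorem NLe.dist_inf (s t r : Ty A) : NLe ((s ∧ₜ r) ∨ₜ (t ∧ₜ r)) ((s ∨ₜ t) ∧ₜ r) :=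
  .sup_le (.le_inf ((NLe.inf_left _ _).trans (.sup_left _ _)) (.inf_right _ _))
    (.le_inf ((NLe.inf_left _ _).trans (.sup_right _ _)) (.inf_right _ _))

theorem NLe.dist_sup (s t r : Ty A) : NLe ((s ∧ₜ t) ∨ₜ r) ((s ∨ₜ r) ∧ₜ (t ∨ₜ r)) :=
  .sup_le (.le_inf ((NLe.inf_left _ _).trans (.sup_left _ _))
      ((NLe.inf_right _ _).trans (.sup_left _ _)))
    (.le_inf (.sup_right _ _) (.sup_right _ _))

theorem Inner.biEq {s t : Ty A} (h : Inner s t) : BiEq s t := by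
  cases h with
  | atom a =>
    have key : PLe (.arr [] [.atom a]) (.atom a) := .arr_atom (by simpa using .atom a)
    exact ⟨⟨by simpa [RLe, cnf, dnf, UnionLe] using key,
      by simpa [LLe, cnf, dnf, InterLe] using key⟩, (NLe.atom_arr a _).rLe_and_lLe⟩
  | omega h _ => exact .of_nLe (.le_omega _) h
  | arr_inf s t r =>
    refine ⟨(NLe.le_inf (.arr_mono (.refl _) (.inf_left _ _))
      (.arr_mono (.refl _) (.inf_right _ _))).rLe_and_lLe, ?_, ?_⟩
    · intro D hD
      refine ⟨D, ?_, UnionLe.refl D⟩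
      simp only [cnf, List.mem_append, List.mem_map, List.mem_flatMap] at hD ⊢
      obtain ⟨p, ⟨l, hl, m, hm | hm, hp⟩, rfl⟩ := hD
      · exact .inl ⟨p, ⟨l, hl, m, hm, hp⟩, rfl⟩
      · exact .inr ⟨p, ⟨l, hl, m, hm, hp⟩, rfl⟩
    · intro C hC
      refine ⟨_, List.mem_singleton_self _, fun p hp => ⟨p, ?_, PLe.refl p⟩⟩
      simp only [dnf, List.flatMap_cons, List.flatMap_nil, List.map_cons, List.map_nil,
        List.append_nil, List.mem_singleton] at hC
      subst hC
      simp only [cnf, List.mem_append, List.mem_map, List.mem_flatMap] at hp ⊢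
      obtain ⟨l, hl, m, hm | hm, hp⟩ := hp
      · exact .inl ⟨l, hl, m, hm, hp⟩
      · exact .inr ⟨l, hl, m, hm, hp⟩
  | sup_arr s t r =>
    refine ⟨(NLe.le_inf (.arr_mono (.sup_left _ _) (.refl _))
      (.arr_mono (.sup_right _ _) (.refl _))).rLe_and_lLe, ?_, ?_⟩
    · intro D hD
      refine ⟨D, ?_, UnionLe.refl D⟩
      simp only [cnf, dnf, List.mem_append, List.mem_map, List.mem_flatMap] at hD ⊢
      obtain ⟨p, ⟨l, hl | hl, hp⟩, rfl⟩ := hD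
      · exact .inl ⟨p, ⟨l, hl, hp⟩, rfl⟩
      · exact .inr ⟨p, ⟨l, hl, hp⟩, rfl⟩
    · intro C hC
      refine ⟨_, List.mem_singleton_self _, fun p hp => ⟨p, ?_, PLe.refl p⟩⟩
      simp only [dnf, List.flatMap_cons, List.flatMap_nil, List.map_cons, List.map_nil,
        List.append_nil, List.mem_singleton] at hC
      subst hC
      simp only [dnf, List.mem_append, List.mem_flatMap] at hp ⊢
      obtain ⟨l, hl | hl, hp⟩ := hp
      · exact .inl ⟨l, hl, hp⟩
      · exact .inr ⟨l, hl, hp⟩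
  | dist_left s t r z =>
    have h := (NLe.dist_inf s t r).rLe_and_lLe.2
    exact ⟨⟨rLe_arr h (.refl z), lLe_arr h (.refl z)⟩,
      rLe_arr (.dist s t r) (.refl z), lLe_arr (.dist s t r) (.refl z)⟩
  | dist_right s t r z =>
    have h := (NLe.dist_sup t r z).rLe_and_lLe.1
    exact ⟨⟨rLe_arr (.refl s) h, lLe_arr (.refl s) h⟩,
      rLe_arr (.refl s) (.dist t r z), lLe_arr (.refl s) (.dist t r z)⟩
  | erase_inf h => exact .of_nLe (.inf_left _ _) (.le_inf (.refl _) h)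
  | erase_sup h => exact .of_nLe (.sup_le h (.refl _)) (.sup_right _ _)

theorem RLe.inf_mono {s s' t t' : Ty A} (h₁ : RLe s s') (h₂ : RLe t t') :
    RLe (s ∧ₜ t) (s' ∧ₜ t') :=
  .le_inf ((RLe.inf_left _ _).trans h₁) ((RLe.inf_right _ _).trans h₂)

theorem RLe.sup_mono {s s' t t' : Ty A} (h₁ : RLe s s') (h₂ : RLe t t') :
    RLe (s ∨ₜ t) (s' ∨ₜ t') :=
  .sup_le (h₁.trans (RLe.sup_left _ _)) (h₂.trans (RLe.sup_right _ _))

theorem LLe.inf_mono {s s' t t' : Ty A} (h₁ : LLe s s') (h₂ : LLe t t') :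
    LLe (s ∧ₜ t) (s' ∧ₜ t') :=
  .le_inf ((LLe.inf_left _ _).trans h₁) ((LLe.inf_right _ _).trans h₂)

theorem LLe.sup_mono {s s' t t' : Ty A} (h₁ : LLe s s') (h₂ : LLe t t') :
    LLe (s ∨ₜ t) (s' ∨ₜ t') :=
  .sup_le (h₁.trans (LLe.sup_left _ _)) (h₂.trans (LLe.sup_right _ _))

theorem BiEq.fill {u v : Ty A} (h : BiEq u v) : ∀ C : Ctx A, BiEq (C.fill u) (C.fill v)
  | .hole => h
  | .arrLeft C s =>
    let ⟨⟨_, h₂⟩, _, h₄⟩ := h.fill C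
    ⟨⟨rLe_arr h₄ (.refl s), lLe_arr h₄ (.refl s)⟩, rLe_arr h₂ (.refl s), lLe_arr h₂ (.refl s)⟩
  | .arrRight s C =>
    let ⟨⟨h₁, _⟩, h₃, _⟩ := h.fill C
    ⟨⟨rLe_arr (.refl s) h₁, lLe_arr (.refl s) h₁⟩, rLe_arr (.refl s) h₃, lLe_arr (.refl s) h₃⟩
  | .infLeft C s =>
    let ⟨⟨h₁, h₂⟩, h₃, h₄⟩ := h.fill C
    ⟨⟨h₁.inf_mono (.refl s), h₂.inf_mono (.refl s)⟩, h₃.inf_mono (.refl s), h₄.inf_mono (.refl s)⟩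
  | .infRight s C =>
    let ⟨⟨h₁, h₂⟩, h₃, h₄⟩ := h.fill C
    ⟨⟨.inf_mono (.refl s) h₁, .inf_mono (.refl s) h₂⟩, .inf_mono (.refl s) h₃,
      .inf_mono (.refl s) h₄⟩
  | .supLeft C s =>
    let ⟨⟨h₁, h₂⟩, h₃, h₄⟩ := h.fill C
    ⟨⟨h₁.sup_mono (.refl s), h₂.sup_mono (.refl s)⟩, h₃.sup_mono (.refl s), h₄.sup_mono (.refl s)⟩
  | .supRight s C =>
    let ⟨⟨h₁, h₂⟩, h₃, h₄⟩ := h.fill C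
    ⟨⟨.sup_mono (.refl s) h₁, .sup_mono (.refl s) h₂⟩, .sup_mono (.refl s) h₃,
      .sup_mono (.refl s) h₄⟩

theorem RLe.fill {u v : Ty A} (h : RLe u v) :
    ∀ C : Ctx A, C.TopLevel → RLe (C.fill u) (C.fill v)
  | .hole, _ => h
  | .infLeft C s, hC => (h.fill C hC).inf_mono (.refl s)
  | .infRight s C, hC => .inf_mono (.refl s) (h.fill C hC)
  | .supLeft C s, hC => (h.fill C hC).sup_mono (.refl s)
  | .supRight s C, hC => .sup_mono (.refl s) (h.fill C hC)

/-- Reduction steps preserve the conjunctive form up to equivalence. Both forms are needed for the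
inner rules, which apply on either side of an arrow; distribution at top level needs only this
one. -/
theorem Top.rLe {s t : Ty A} (h : Top s t) : RLe s t ∧ RLe t s := by
  cases h with
  | ctx C h => exact ⟨(h.biEq.fill C).1.1, (h.biEq.fill C).2.1⟩
  | dist C s t r hC =>
    exact ⟨(NLe.dist_sup s t r).rLe_and_lLe.1.fill C hC, (RLe.dist s t r).fill C hC⟩

theorem ACEq.nLe {s t : Ty A} (h : ACEq s t) : NLe s t ∧ NLe t s := by
  induction h with
  | refl s => exact ⟨.refl s, .refl s⟩
  | symm _ ih => exact ih.symm
  | trans _ _ h₁ h₂ => exact ⟨h₁.1.trans h₂.1, h₂.2.trans h₁.2⟩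
  | inf_comm s t =>
    exact ⟨.le_inf (.inf_right _ _) (.inf_left _ _), .le_inf (.inf_right _ _) (.inf_left _ _)⟩
  | inf_assoc s t r =>
    exact ⟨.le_inf ((NLe.inf_left _ _).trans (.inf_left _ _))
        (.le_inf ((NLe.inf_left _ _).trans (.inf_right _ _)) (.inf_right _ _)),
      .le_inf (.le_inf (.inf_left _ _) ((NLe.inf_right _ _).trans (.inf_left _ _)))
        ((NLe.inf_right _ _).trans (.inf_right _ _))⟩
  | sup_comm s t =>
    exact ⟨.sup_le (.sup_right _ _) (.sup_left _ _), .sup_le (.sup_right _ _) (.sup_left _ _)⟩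
  | sup_assoc s t r =>
    exact ⟨.sup_le (.sup_le (.sup_left _ _) ((NLe.sup_left _ _).trans (.sup_right _ _)))
        ((NLe.sup_right _ _).trans (.sup_right _ _)),
      .sup_le ((NLe.sup_left _ _).trans (.sup_left _ _))
        (.sup_le ((NLe.sup_right _ _).trans (.sup_left _ _)) (.sup_right _ _))⟩
  | arr _ _ h₁ h₂ => exact ⟨.arr_mono h₁.2 h₂.1, .arr_mono h₁.1 h₂.2⟩
  | inf _ _ h₁ h₂ =>
    exact ⟨.le_inf ((NLe.inf_left _ _).trans h₁.1) ((NLe.inf_right _ _).trans h₂.1),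
      .le_inf ((NLe.inf_left _ _).trans h₁.2) ((NLe.inf_right _ _).trans h₂.2)⟩
  | sup _ _ h₁ h₂ =>
    exact ⟨.sup_le (h₁.1.trans (.sup_left _ _)) (h₂.1.trans (.sup_right _ _)),
      .sup_le (h₁.2.trans (.sup_left _ _)) (h₂.2.trans (.sup_right _ _))⟩

theorem ACEq.rLe {s t : Ty A} (h : ACEq s t) : RLe s t := h.nLe.1.rLe_and_lLe.1

theorem mk_eq_mk {s t : Ty A} : TyAC.mk s = TyAC.mk t ↔ ACEq s t :=
  Quotient.eq (r := acSetoid A)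

theorem Steps.rLe {p q : TyAC A} (h : Steps p q) :
    ∀ s t : Ty A, TyAC.mk s = p → TyAC.mk t = q → RLe s t ∧ RLe t s := by
  induction h with
  | refl =>
    rintro s t hs rfl
    exact ⟨(mk_eq_mk.1 hs).rLe, (mk_eq_mk.1 hs.symm).rLe⟩
  | tail _ h ih =>
    rintro s t hs rfl
    obtain ⟨u, v, hu, hv, huv⟩ := h
    obtain ⟨h₁, h₂⟩ := ih s u hs hu
    exact ⟨h₁.trans (huv.rLe.1.trans (mk_eq_mk.1 hv).rLe),
      (mk_eq_mk.1 hv.symm).rLe.trans (huv.rLe.2.trans h₂)⟩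

/-! ### Termination -/

/-- Whether a type is read at top level or to the right of an arrow (`right`), where unions are
distributed over intersections, or to the left of an arrow (`left`), where intersections are
distributed over unions. -/
inductive Mode where
  | left : Mode
  | right : Mode

/-- A weight that decreases along the rules. The connective that is distributed over the other one
is interpreted by multiplication, the other one by addition and one. The exponential makes an arrow
heavier than both the sum and the product of the two arrows into which it splits. -/
def wt : Mode → Ty A → ℕ
  | _, .atom _ => 2
  | _, .omega => 2
  | _, .arr s t => 2 ^ (wt .left s * wt .right t)
  | .right, .inf s t => wt .right s + wt .right t + 1
  | .left, .inf s t => wt .left s * wt .left t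
  | .right, .sup s t => wt .right s * wt .right t
  | .left, .sup s t => wt .left s + wt .left t + 1

theorem two_le_wt (m : Mode) (s : Ty A) : 2 ≤ wt m s := by
  induction s generalizing m with
  | atom | omega => simp [wt]
  | arr s t hs ht =>
    rw [wt]
    have := Nat.mul_le_mul (hs .left) (ht .right)
    exact Nat.le_self_pow (by omega) 2
  | inf s t hs ht | sup s t hs ht =>
    have h₁ := hs m
    have h₂ := ht m
    cases m <;> simp only [wt] <;> nlinarith

theorem ACEq.wt_eq {s t : Ty A} (h : ACEq s t) (m : Mode) : wt m s = wt m t := by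
  induction h generalizing m with
  | refl => rfl
  | symm _ ih => exact (ih m).symm
  | trans _ _ h₁ h₂ => exact (h₁ m).trans (h₂ m)
  | inf_comm | inf_assoc | sup_comm | sup_assoc => cases m <;> simp only [wt] <;> ring
  | arr _ _ h₁ h₂ => simp only [wt, h₁, h₂]
  | inf _ _ h₁ h₂ | sup _ _ h₁ h₂ => cases m <;> simp only [wt, h₁, h₂]

theorem wt_inf_lt (m : Mode) (s t : Ty A) : wt m s < wt m (s ∧ₜ t) := by
  have h₁ := two_le_wt m s
  have h₂ := two_le_wt m t
  cases m <;> simp only [wt] <;> nlinarith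

theorem wt_sup_lt (m : Mode) (s t : Ty A) : wt m t < wt m (s ∨ₜ t) := by
  have h₁ := two_le_wt m s
  have h₂ := two_le_wt m t
  cases m <;> simp only [wt] <;> nlinarith

/-- Splitting an arrow decreases the weight in both modes. -/
theorem wt_inf_lt_of_split (m : Mode) {s t : Ty A} {x y z : ℕ} (hs : wt m s = 2 ^ x)
    (ht : wt m t = 2 ^ y) (hz : x + y + 2 ≤ z) : wt m (s ∧ₜ t) < 2 ^ z := by
  have h₁ : 1 ≤ 2 ^ x := Nat.one_le_two_pow
  have h₂ : 1 ≤ 2 ^ y := Nat.one_le_two_pow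
  have h₃ : 2 ^ (x + y + 2) ≤ 2 ^ z := Nat.pow_le_pow_right (by omega) hz
  have h₄ : 2 ^ (x + y + 2) = 4 * (2 ^ x * 2 ^ y) := by ring
  cases m <;> simp only [wt, hs, ht] <;> nlinarith

theorem wt_arr (m : Mode) (s t : Ty A) : wt m (s ⟶ₜ t) = 2 ^ (wt .left s * wt .right t) := by
  cases m <;> rfl

theorem wt_dist_lt (s t r : Ty A) :
    wt .right ((s ∨ₜ r) ∧ₜ (t ∨ₜ r)) < wt .right ((s ∧ₜ t) ∨ₜ r) := by
  have := two_le_wt .right r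
  simp only [wt]
  nlinarith

theorem wt_arr_lt_left {s s' : Ty A} (h : wt .left s < wt .left s') (m : Mode) (t : Ty A) :
    wt m (s ⟶ₜ t) < wt m (s' ⟶ₜ t) := by
  rw [wt_arr, wt_arr]
  exact Nat.pow_lt_pow_right (by omega)
    (Nat.mul_lt_mul_of_pos_right h (by have := two_le_wt .right t; omega))

theorem wt_arr_lt_right {t t' : Ty A} (h : wt .right t < wt .right t') (m : Mode) (s : Ty A) :
    wt m (s ⟶ₜ t) < wt m (s ⟶ₜ t') := by
  rw [wt_arr, wt_arr]
  exact Nat.pow_lt_pow_right (by omega)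
    (Nat.mul_lt_mul_of_pos_left h (by have := two_le_wt .left s; omega))

theorem Inner.wt_lt {s t : Ty A} (h : Inner s t) (m : Mode) : wt m t < wt m s := by
  cases h with
  | atom a => cases m <;> simp [wt]
  | @omega s h hs =>
    have ho : wt m (Ty.omega : Ty A) = 2 := by cases m <;> rfl
    rw [ho]
    cases s with
    | atom a => exact absurd h (not_omega_nLe_atom a)
    | omega => exact absurd rfl hs
    | arr s t =>
      have h₁ := Nat.mul_le_mul (two_le_wt .left s) (two_le_wt .right t)
      rw [wt_arr]
      calc 2 < 2 ^ 4 := by norm_num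
        _ ≤ _ := Nat.pow_le_pow_right (by omega) h₁
    | inf s t => exact (two_le_wt m s).trans_lt (wt_inf_lt m s t)
    | sup s t => exact (two_le_wt m t).trans_lt (wt_sup_lt m s t)
  | arr_inf s t r =>
    rw [wt_arr m s (t ∧ₜ r)]
    have := two_le_wt .left s
    exact wt_inf_lt_of_split m (wt_arr m s t) (wt_arr m s r) (by simp only [wt]; nlinarith)
  | sup_arr s t r =>
    rw [wt_arr m (s ∨ₜ t) r]
    have := two_le_wt .right r
    exact wt_inf_lt_of_split m (wt_arr m s r) (wt_arr m t r) (by simp only [wt]; nlinarith)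
  | dist_left s t r z =>
    refine wt_arr_lt_left ?_ m z
    have := two_le_wt .left r
    simp only [wt]
    nlinarith
  | dist_right s t r z => exact wt_arr_lt_right (wt_dist_lt t r z) m s
  | erase_inf _ => exact wt_inf_lt m _ _
  | erase_sup _ => exact wt_sup_lt m _ _

theorem wt_inf_lt_left {m : Mode} {s s' : Ty A} (h : wt m s < wt m s') (t : Ty A) :
    wt m (s ∧ₜ t) < wt m (s' ∧ₜ t) := by
  have := two_le_wt m t
  cases m <;> simp only [wt] <;> nlinarith

theorem wt_sup_lt_left {m : Mode} {s s' : Ty A} (h : wt m s < wt m s') (t : Ty A) :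
    wt m (s ∨ₜ t) < wt m (s' ∨ₜ t) := by
  have := two_le_wt m t
  cases m <;> simp only [wt] <;> nlinarith

theorem wt_inf_lt_right {m : Mode} {s s' : Ty A} (h : wt m s < wt m s') (t : Ty A) :
    wt m (t ∧ₜ s) < wt m (t ∧ₜ s') := by
  simpa only [(ACEq.inf_comm t _).wt_eq m] using wt_inf_lt_left h t

theorem wt_sup_lt_right {m : Mode} {s s' : Ty A} (h : wt m s < wt m s') (t : Ty A) :
    wt m (t ∨ₜ s) < wt m (t ∨ₜ s') := by
  simpa only [(ACEq.sup_comm t _).wt_eq m] using wt_sup_lt_left h t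

theorem wt_fill_lt {u v : Ty A} (h : ∀ m, wt m u < wt m v) :
    ∀ (C : Ctx A) (m : Mode), wt m (C.fill u) < wt m (C.fill v)
  | .hole, m => h m
  | .arrLeft C s, m => wt_arr_lt_left (wt_fill_lt h C .left) m s
  | .arrRight s C, m => wt_arr_lt_right (wt_fill_lt h C .right) m s
  | .infLeft C s, m => wt_inf_lt_left (wt_fill_lt h C m) s
  | .infRight s C, m => wt_inf_lt_right (wt_fill_lt h C m) s
  | .supLeft C s, m => wt_sup_lt_left (wt_fill_lt h C m) s
  | .supRight s C, m => wt_sup_lt_right (wt_fill_lt h C m) s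

theorem wt_right_fill_lt {u v : Ty A} (h : wt .right u < wt .right v) :
    ∀ C : Ctx A, C.TopLevel → wt .right (C.fill u) < wt .right (C.fill v)
  | .hole, _ => h
  | .infLeft C s, hC => wt_inf_lt_left (wt_right_fill_lt h C hC) s
  | .infRight s C, hC => wt_inf_lt_right (wt_right_fill_lt h C hC) s
  | .supLeft C s, hC => wt_sup_lt_left (wt_right_fill_lt h C hC) s
  | .supRight s C, hC => wt_sup_lt_right (wt_right_fill_lt h C hC) s

theorem Top.wt_lt {s t : Ty A} (h : Top s t) : wt .right t < wt .right s := by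
  cases h with
  | ctx C h => exact wt_fill_lt h.wt_lt C .right
  | dist C s t r hC => exact wt_right_fill_lt (wt_dist_lt s t r) C hC

theorem terminating (A : Type*) : Terminating A := by
  let w : TyAC A → ℕ := Quotient.lift (wt .right) fun _ _ h => ACEq.wt_eq h .right
  refine Subrelation.wf (r := InvImage (· < ·) w) ?_ (InvImage.wf w Nat.lt_wfRel.wf)
  rintro q p ⟨s, t, rfl, rfl, h⟩
  exact h.wt_lt

/-! ### Iterated intersections and unions -/

/-- The properties shared by intersection and union that are used below: the laws of `ACEq`, the
contexts `f · s`, and an erasure rule for comparable operands. -/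
structure ACOp (f : Ty A → Ty A → Ty A) : Prop where
  comm (s t : Ty A) : ACEq (f s t) (f t s)
  assoc (s t r : Ty A) : ACEq (f (f s t) r) (f s (f t r))
  congr {s s' t t' : Ty A} : ACEq s s' → ACEq t t' → ACEq (f s t) (f s' t')
  ctx (s : Ty A) : ∃ C : Ctx A, ∀ u, C.fill u = f u s
  erase {s t : Ty A} : NLe s t → ∃ u, Inner (f s t) u

theorem acOp_inf : ACOp (Ty.inf : Ty A → Ty A → Ty A) where
  comm := .inf_comm
  assoc := .inf_assoc
  congr := .inf
  ctx s := ⟨.infLeft .hole s, fun _ => rfl⟩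
  erase h := ⟨_, .erase_inf h⟩

theorem acOp_sup : ACOp (Ty.sup : Ty A → Ty A → Ty A) where
  comm := .sup_comm
  assoc := .sup_assoc
  congr := .sup
  ctx s := ⟨.supLeft .hole s, fun _ => rfl⟩
  erase h := ⟨_, .erase_sup h⟩

/-- The iteration of `f` over a list; the empty iteration is `ω`, also for unions, where it is
never used. -/
def big (f : Ty A → Ty A → Ty A) : List (Ty A) → Ty A
  | [] => .omega
  | [x] => x
  | x :: y :: l => f x (big f (y :: l))

theorem big_cons (f : Ty A → Ty A → Ty A) (x : Ty A) {l : List (Ty A)} (hl : l ≠ []) :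
    big f (x :: l) = f x (big f l) := by
  cases l with
  | nil => exact absurd rfl hl
  | cons y l => rfl

theorem ACOp.big_cons_congr {f : Ty A → Ty A → Ty A} (hf : ACOp f) {x x' : Ty A}
    {l l' : List (Ty A)} (hx : ACEq x x') (hl : ACEq (big f l) (big f l')) (h : l = [] ↔ l' = []) :
    ACEq (big f (x :: l)) (big f (x' :: l')) := by
  by_cases hn : l = []
  · rw [h.1 hn, hn]
    exact hx
  · rw [big_cons f x hn, big_cons f x' (mt h.2 hn)]
    exact hf.congr hx hl

theorem ACOp.big_append {f : Ty A → Ty A → Ty A} (hf : ACOp f) {l l' : List (Ty A)} (hl : l ≠ [])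
    (hl' : l' ≠ []) : ACEq (big f (l ++ l')) (f (big f l) (big f l')) := by
  induction l with
  | nil => exact absurd rfl hl
  | cons x l ih =>
    rw [List.cons_append, big_cons f x (by simp [hl'])]
    by_cases hn : l = []
    · subst hn
      exact .refl _
    · rw [big_cons f x hn]
      exact (hf.congr (.refl x) (ih hn)).trans (hf.assoc _ _ _).symm

theorem ACOp.big_perm {f : Ty A → Ty A → Ty A} (hf : ACOp f) {l l' : List (Ty A)}
    (h : l.Perm l') : ACEq (big f l) (big f l') := by
  induction h with
  | nil => exact .refl _
  | cons x h ih =>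
    exact hf.big_cons_congr (.refl x) ih ⟨fun e => by subst e; simpa using h,
      fun e => by subst e; simpa using h⟩
  | swap x y l =>
    by_cases hn : l = []
    · subst hn
      exact hf.comm y x
    · rw [big_cons f y (List.cons_ne_nil x l), big_cons f x hn,
        big_cons f x (List.cons_ne_nil y l), big_cons f y hn]
      exact (hf.assoc y x _).symm.trans ((hf.congr (hf.comm y x) (.refl _)).trans (hf.assoc x y _))
  | trans _ _ h₁ h₂ => exact h₁.trans h₂

/-- A representative of a class. -/
noncomputable def TyAC.out (p : TyAC A) : Ty A := Quotient.out (s := acSetoid A) p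

theorem acEq_out (s : Ty A) : ACEq s (TyAC.mk s).out :=
  mk_eq_mk.1 (Quotient.out_eq (s := acSetoid A) (TyAC.mk s)).symm

theorem ACOp.big_map_out {f : Ty A → Ty A → Ty A} (hf : ACOp f) (l : List (Ty A)) :
    ACEq (big f l) (big f ((l.map TyAC.mk).map TyAC.out)) := by
  induction l with
  | nil => exact .refl _
  | cons x l ih =>
    exact hf.big_cons_congr (acEq_out x) ih (by simp)

/-- A list without repetitions whose members are pairwise incomparable. -/
def Irredundant (l : List (Ty A)) : Prop := l.Nodup ∧ ∀ x ∈ l, ∀ y ∈ l, NLe x y → x = y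

theorem ACOp.big_acEq {f : Ty A → Ty A → Ty A} (hf : ACOp f) {l l' : List (Ty A)}
    (hl : Irredundant l) (hl' : Irredundant l') (h : ∀ x ∈ l, ∃ y ∈ l', ACEq x y)
    (h' : ∀ y ∈ l', ∃ x ∈ l, ACEq x y) : ACEq (big f l) (big f l') := by
  have nodup {k : List (Ty A)} (hk : Irredundant k) : (k.map TyAC.mk).Nodup :=
    hk.1.map_on fun x hx y hy e => hk.2 x hx y hy (mk_eq_mk.1 e).nLe.1
  have hp : (l.map TyAC.mk).Perm (l'.map TyAC.mk) := by
    refine (List.perm_ext_iff_of_nodup (nodup hl) (nodup hl')).2 fun p => ?_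
    simp only [List.mem_map]
    constructor
    · rintro ⟨x, hx, rfl⟩
      obtain ⟨y, hy, hxy⟩ := h x hx
      exact ⟨y, hy, mk_eq_mk.2 hxy.symm⟩
    · rintro ⟨y, hy, rfl⟩
      obtain ⟨x, hx, hxy⟩ := h' y hy
      exact ⟨x, hx, mk_eq_mk.2 hxy⟩
  exact (hf.big_map_out l).trans ((hf.big_perm (hp.map _)).trans (hf.big_map_out l').symm)

/-- Two irredundant lists that dominate each other agree up to order: going from one list to the
other and back along `R` leads to a comparable member, hence to the same one. -/
theorem ACOp.big_acEq_of_rel {f : Ty A → Ty A → Ty A} (hf : ACOp f) {l l' : List (Ty A)}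
    (hl : Irredundant l) (hl' : Irredundant l') {R : Ty A → Ty A → Prop}
    (trans : ∀ {x y z}, R x y → R y z → R x z)
    (hR : ∀ x ∈ l, ∀ y ∈ l, R x y → x = y) (hR' : ∀ x ∈ l', ∀ y ∈ l', R x y → x = y)
    (h : ∀ x ∈ l, ∃ y ∈ l', R x y) (h' : ∀ y ∈ l', ∃ x ∈ l, R y x)
    (hac : ∀ x ∈ l, ∀ y ∈ l', R x y → R y x → ACEq x y) : ACEq (big f l) (big f l') := by
  refine hf.big_acEq hl hl' (fun x hx => ?_) (fun y hy => ?_)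
  · obtain ⟨y, hy, hxy⟩ := h x hx
    obtain ⟨z, hz, hyz⟩ := h' y hy
    obtain rfl := hR x hx z hz (trans hxy hyz)
    exact ⟨y, hy, hac x hx y hy hxy hyz⟩
  · obtain ⟨x, hx, hyx⟩ := h' y hy
    obtain ⟨z, hz, hxz⟩ := h x hx
    obtain rfl := hR' y hy z hz (trans hyx hxz)
    exact ⟨x, hx, hac x hx y hy hxz hyx⟩

/-- The list of the members of an iterated intersection. -/
def infs : Ty A → List (Ty A)
  | .inf s t => infs s ++ infs t
  | s => [s]

/-- The list of the members of an iterated union. -/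
def sups : Ty A → List (Ty A)
  | .sup s t => sups s ++ sups t
  | s => [s]

/-- The members of an iterated intersection, where `ω` counts as the empty intersection. -/
def conjuncts : Ty A → List (Ty A)
  | .omega => []
  | s => infs s

theorem infs_ne_nil (s : Ty A) : infs s ≠ [] := by
  induction s <;> simp_all [infs]

theorem sups_ne_nil (s : Ty A) : sups s ≠ [] := by
  induction s <;> simp_all [sups]

theorem acEq_big_infs (s : Ty A) : ACEq s (big Ty.inf (infs s)) := by
  induction s with
  | inf s t hs ht =>
    exact (ACEq.inf hs ht).trans (acOp_inf.big_append (infs_ne_nil s) (infs_ne_nil t)).symm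
  | _ => exact .refl _

theorem acEq_big_sups (s : Ty A) : ACEq s (big Ty.sup (sups s)) := by
  induction s with
  | sup s t hs ht =>
    exact (ACEq.sup hs ht).trans (acOp_sup.big_append (sups_ne_nil s) (sups_ne_nil t)).symm
  | _ => exact .refl _

theorem acEq_big_conjuncts (s : Ty A) : ACEq s (big Ty.inf (conjuncts s)) := by
  cases s with
  | omega => exact .refl _
  | _ => exact acEq_big_infs _

theorem mem_infs_of_mem_conjuncts {s x : Ty A} (h : x ∈ conjuncts s) : x ∈ infs s := by
  cases s with
  | omega => simp [conjuncts] at h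
  | _ => exact h

theorem conjuncts_eq_nil {s : Ty A} (h : conjuncts s = []) : s = .omega := by
  cases s with
  | omega => rfl
  | _ => exact absurd h (infs_ne_nil _)

theorem eq_of_infs_eq_singleton {s x : Ty A} (h : infs s = [x]) : s = x := by
  cases s with
  | inf s t =>
    have h₁ := List.length_pos_of_ne_nil (infs_ne_nil s)
    have h₂ := List.length_pos_of_ne_nil (infs_ne_nil t)
    have := congrArg List.length h
    simp only [infs, List.length_append, List.length_singleton] at this
    omega
  | _ => simpa [infs] using h

theorem eq_of_sups_eq_singleton {s x : Ty A} (h : sups s = [x]) : s = x := by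
  cases s with
  | sup s t =>
    have h₁ := List.length_pos_of_ne_nil (sups_ne_nil s)
    have h₂ := List.length_pos_of_ne_nil (sups_ne_nil t)
    have := congrArg List.length h
    simp only [sups, List.length_append, List.length_singleton] at this
    omega
  | _ => simpa [sups] using h

theorem ne_inf_of_mem_infs {s x : Ty A} (h : x ∈ infs s) (a b : Ty A) : x ≠ a ∧ₜ b := by
  induction s with
  | inf s t hs ht => exact (List.mem_append.1 h).elim hs ht
  | _ => rintro rfl; simp [infs] at h

theorem ne_sup_of_mem_sups {s x : Ty A} (h : x ∈ sups s) (a b : Ty A) : x ≠ a ∨ₜ b := by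
  induction s with
  | sup s t hs ht => exact (List.mem_append.1 h).elim hs ht
  | _ => rintro rfl; simp [sups] at h

theorem eq_or_acEq_of_mem_infs {s x : Ty A} (h : x ∈ infs s) :
    s = x ∨ ∃ z, ACEq s (x ∧ₜ z) := by
  induction s with
  | inf s t hs ht =>
    refine .inr ?_
    rcases List.mem_append.1 h with h | h
    · obtain rfl | ⟨z, hz⟩ := hs h
      · exact ⟨t, .refl _⟩
      · exact ⟨z ∧ₜ t, (ACEq.inf hz (.refl t)).trans (.inf_assoc _ _ _)⟩
    · obtain rfl | ⟨z, hz⟩ := ht h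
      · exact ⟨s, .inf_comm _ _⟩
      · exact ⟨z ∧ₜ s, (ACEq.inf_comm _ _).trans ((ACEq.inf hz (.refl s)).trans
          (.inf_assoc _ _ _))⟩
  | _ => exact .inl (by simpa [infs, eq_comm] using h)

theorem eq_or_acEq_of_mem_sups {s x : Ty A} (h : x ∈ sups s) :
    s = x ∨ ∃ z, ACEq s (x ∨ₜ z) := by
  induction s with
  | sup s t hs ht =>
    refine .inr ?_
    rcases List.mem_append.1 h with h | h
    · obtain rfl | ⟨z, hz⟩ := hs h
      · exact ⟨t, .refl _⟩
      · exact ⟨z ∨ₜ t, (ACEq.sup hz (.refl t)).trans (.sup_assoc _ _ _)⟩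
    · obtain rfl | ⟨z, hz⟩ := ht h
      · exact ⟨s, .sup_comm _ _⟩
      · exact ⟨z ∨ₜ s, (ACEq.sup_comm _ _).trans ((ACEq.sup hz (.refl s)).trans
          (.sup_assoc _ _ _))⟩
  | _ => exact .inl (by simpa [sups, eq_comm] using h)

theorem nLe_of_mem_conjuncts {s x : Ty A} (h : x ∈ conjuncts s) : NLe s x := by
  obtain rfl | ⟨z, hz⟩ := eq_or_acEq_of_mem_infs (mem_infs_of_mem_conjuncts h)
  · exact .refl _
  · exact hz.nLe.1.trans (.inf_left _ _)

theorem nLe_of_mem_sups {s x : Ty A} (h : x ∈ sups s) : NLe x s := by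
  obtain rfl | ⟨z, hz⟩ := eq_or_acEq_of_mem_sups h
  · exact .refl _
  · exact (NLe.sup_left _ _).trans hz.nLe.2

theorem nLe_of_forall_conjuncts {s t : Ty A} (h : ∀ x ∈ conjuncts t, NLe s x) : NLe s t := by
  have key : ∀ t : Ty A, (∀ x ∈ infs t, NLe s x) → NLe s t := by
    intro t
    induction t with
    | inf t r ht hr =>
      intro h
      simp only [infs, List.mem_append] at h
      exact .le_inf (ht fun x hx => h x (.inl hx)) (hr fun x hx => h x (.inr hx))
    | _ => exact fun h => h _ (List.mem_singleton_self _)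
  cases t with
  | omega => exact .le_omega s
  | _ => exact key _ h

theorem nLe_of_forall_sups {s t : Ty A} (h : ∀ x ∈ sups s, NLe x t) : NLe s t := by
  induction s with
  | sup s r hs hr =>
    simp only [sups, List.mem_append] at h
    exact .sup_le (hs fun x hx => h x (.inl hx)) (hr fun x hx => h x (.inr hx))
  | _ => exact h _ (List.mem_singleton_self _)

theorem sizeOf_le_of_mem_conjuncts {s x : Ty A} (h : x ∈ conjuncts s) : sizeOf x ≤ sizeOf s := by
  replace h := mem_infs_of_mem_conjuncts h
  induction s with
  | inf s t hs ht =>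
    rcases List.mem_append.1 h with h | h
    · have := hs h
      simp; omega
    · have := ht h
      simp; omega
  | _ => simp [infs] at h; simp [h]

theorem sizeOf_le_of_mem_sups {s x : Ty A} (h : x ∈ sups s) : sizeOf x ≤ sizeOf s := by
  induction s with
  | sup s t hs ht =>
    rcases List.mem_append.1 h with h | h
    · have := hs h
      simp; omega
    · have := ht h
      simp; omega
  | _ => simp [sups] at h; simp [h]

/-! ### Normal types -/

/-- No inner rule applies anywhere in the type, modulo associativity and commutativity. -/
def INormal (s : Ty A) : Prop := ∀ (C : Ctx A) (u v : Ty A), ACEq s (C.fill u) → ¬ Inner u v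

theorem IsNormal.iNormal {s : Ty A} (h : IsNormal (TyAC.mk s)) : INormal s :=
  fun C _ _ hs hu => h _ ⟨_, _, mk_eq_mk.2 hs.symm, rfl, .ctx C hu⟩

theorem INormal.congr {s t : Ty A} (h : INormal s) (hst : ACEq s t) : INormal t :=
  fun C u v ht => h C u v (hst.trans ht)

theorem INormal.not_inner {s t : Ty A} (h : INormal s) : ¬ Inner s t := h .hole s t (.refl s)

theorem INormal.of_arr_left {s t : Ty A} (h : INormal (s ⟶ₜ t)) : INormal s :=
  fun C u v hs => h (.arrLeft C t) u v (.arr hs (.refl t))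

theorem INormal.of_arr_right {s t : Ty A} (h : INormal (s ⟶ₜ t)) : INormal t :=
  fun C u v hs => h (.arrRight s C) u v (.arr (.refl s) hs)

theorem INormal.of_inf {s t : Ty A} (h : INormal (s ∧ₜ t)) : INormal s :=
  fun C u v hs => h (.infLeft C t) u v (.inf hs (.refl t))

theorem INormal.of_sup {s t : Ty A} (h : INormal (s ∨ₜ t)) : INormal s :=
  fun C u v hs => h (.supLeft C t) u v (.sup hs (.refl t))

theorem INormal.of_mem_conjuncts {s x : Ty A} (h : INormal s) (hx : x ∈ conjuncts s) :
    INormal x := by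
  obtain rfl | ⟨z, hz⟩ := eq_or_acEq_of_mem_infs (mem_infs_of_mem_conjuncts hx)
  · exact h
  · exact (h.congr hz).of_inf

theorem INormal.of_mem_sups {s x : Ty A} (h : INormal s) (hx : x ∈ sups s) : INormal x := by
  obtain rfl | ⟨z, hz⟩ := eq_or_acEq_of_mem_sups hx
  · exact h
  · exact (h.congr hz).of_sup

theorem ACOp.irredundant {f : Ty A → Ty A → Ty A} (hf : ACOp f) {s : Ty A} {l : List (Ty A)}
    (h : INormal s) (hs : ACEq s (big f l)) : Irredundant l := by
  -- Two members in different positions can be brought to the front, where an erasure applies.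
  have key {x y : Ty A} {k : List (Ty A)} (hp : l.Perm (x :: y :: k)) : ¬ NLe x y := by
    intro hxy
    obtain ⟨u, hu⟩ := hf.erase hxy
    have hs' := hs.trans (hf.big_perm hp)
    by_cases hk : k = []
    · subst hk
      exact (h.congr hs').not_inner hu
    · rw [big_cons f x (by simp), big_cons f y hk] at hs'
      obtain ⟨C, hC⟩ := hf.ctx (big f k)
      refine h C _ u ?_ hu
      rw [hC]
      exact hs'.trans (hf.assoc _ _ _).symm
  constructor
  · refine List.nodup_iff_sublist.2 fun x hx => ?_
    obtain ⟨k, hk⟩ := hx.exists_perm_append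
    exact key hk (.refl x)
  · intro x hx y hy hxy
    by_contra hne
    classical
    have h₁ := List.perm_cons_erase hx
    have h₂ := List.perm_cons_erase ((List.mem_erase_of_ne (Ne.symm hne)).2 hy)
    exact key (h₁.trans (h₂.cons x)) hxy

theorem INormal.irredundant_conjuncts {s : Ty A} (h : INormal s) : Irredundant (conjuncts s) :=
  acOp_inf.irredundant h (acEq_big_conjuncts s)

theorem INormal.irredundant_sups {s : Ty A} (h : INormal s) : Irredundant (sups s) :=
  acOp_sup.irredundant h (acEq_big_sups s)

theorem Irredundant.eq_singleton_of_forall {l : List (Ty A)} {x : Ty A} (h : Irredundant l)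
    (hn : l ≠ []) (hx : ∀ y ∈ l, y = x) : l = [x] := by
  obtain ⟨y, k, rfl⟩ := List.exists_cons_of_ne_nil hn
  obtain rfl := hx y (by simp)
  cases k with
  | nil => rfl
  | cons z k =>
    obtain rfl := hx z (by simp)
    simpa using h.1

theorem Irredundant.eq_singleton_omega {l : List (Ty A)} (h : Irredundant l)
    (ho : Ty.omega ∈ l) : l = [.omega] :=
  h.eq_singleton_of_forall (List.ne_nil_of_mem ho) fun y hy => h.2 y hy _ ho (.le_omega y)

theorem INormal.ne_omega_of_mem_conjuncts {s x : Ty A} (h : INormal s) (hx : x ∈ conjuncts s) :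
    x ≠ .omega := by
  rintro rfl
  have hc := h.irredundant_conjuncts.eq_singleton_omega hx
  cases s with
  | omega => simp [conjuncts] at hx
  | atom | arr | sup => simp [conjuncts, infs] at hx
  | inf s t => cases eq_of_infs_eq_singleton hc

theorem INormal.ne_omega_of_mem_sups {s x : Ty A} (h : INormal s) (hs : s ≠ .omega)
    (hx : x ∈ sups s) : x ≠ .omega := by
  rintro rfl
  exact hs (eq_of_sups_eq_singleton (h.irredundant_sups.eq_singleton_omega hx))

/-- Atoms and arrows. -/
def Base : Ty A → Prop
  | .atom _ => True
  | .arr _ _ => True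
  | _ => False

theorem base_of_ne {x : Ty A} (h₁ : x ≠ .omega) (h₂ : ∀ a b, x ≠ a ∧ₜ b)
    (h₃ : ∀ a b, x ≠ a ∨ₜ b) : Base x := by
  cases x with
  | atom | arr => trivial
  | omega => exact h₁ rfl
  | inf a b => exact h₂ a b rfl
  | sup a b => exact h₃ a b rfl

theorem INormal.base_of_mem_conjuncts {s t x : Ty A} (h : INormal (s ⟶ₜ t))
    (hx : x ∈ conjuncts s) : Base x := by
  have hx' := mem_infs_of_mem_conjuncts hx
  refine base_of_ne (h.of_arr_left.ne_omega_of_mem_conjuncts hx) (ne_inf_of_mem_infs hx') ?_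
  rintro a b rfl
  obtain rfl | ⟨z, hz⟩ := eq_or_acEq_of_mem_infs hx'
  · exact h.not_inner (.sup_arr _ _ _)
  · exact (h.congr (.arr hz (.refl t))).not_inner (.dist_left _ _ _ _)

theorem INormal.ne_omega_of_arr {s t : Ty A} (h : INormal (s ⟶ₜ t)) : t ≠ .omega := by
  rintro rfl
  exact h.not_inner (.omega (.omega_arr s) (by simp))

theorem INormal.base_of_mem_sups {s t x : Ty A} (h : INormal (s ⟶ₜ t)) (hx : x ∈ sups t) :
    Base x := by
  refine base_of_ne (h.of_arr_right.ne_omega_of_mem_sups h.ne_omega_of_arr hx) ?_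
    (ne_sup_of_mem_sups hx)
  rintro a b rfl
  obtain rfl | ⟨z, hz⟩ := eq_or_acEq_of_mem_sups hx
  · exact h.not_inner (.arr_inf _ _ _)
  · exact (h.congr (.arr (.refl s) hz)).not_inner (.dist_right _ _ _ _)

/-! ### Normal types denote their members -/

/-- Both forms of `x` consist of the single prime type `p`. -/
def Denotes (x : Ty A) (p : PTy A) : Prop := cnf x = [[p]] ∧ dnf x = [[p]]

/-- The members of the first list denote exactly the members of the second list. -/
def DenotesList (l : List (Ty A)) (B : List (PTy A)) : Prop :=
  (∀ x ∈ l, ∃ p ∈ B, Denotes x p) ∧ ∀ p ∈ B, ∃ x ∈ l, Denotes x p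

theorem DenotesList.append {l l' : List (Ty A)} {B B' : List (PTy A)} (h : DenotesList l B)
    (h' : DenotesList l' B') : DenotesList (l ++ l') (B ++ B') := by
  constructor
  · intro x hx
    rcases List.mem_append.1 hx with hx | hx
    · obtain ⟨p, hp, hxp⟩ := h.1 x hx
      exact ⟨p, by simp [hp], hxp⟩
    · obtain ⟨p, hp, hxp⟩ := h'.1 x hx
      exact ⟨p, by simp [hp], hxp⟩
  · intro p hp
    rcases List.mem_append.1 hp with hp | hp
    · obtain ⟨x, hx, hxp⟩ := h.2 p hp
      exact ⟨x, by simp [hx], hxp⟩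
    · obtain ⟨x, hx, hxp⟩ := h'.2 p hp
      exact ⟨x, by simp [hx], hxp⟩

theorem denotesList_singleton {x : Ty A} {p : PTy A} (h : Denotes x p) : DenotesList [x] [p] := by
  simp [DenotesList, h]

theorem exists_dnf_eq {s : Ty A} (h : ∀ x ∈ conjuncts s, ∃ p, Denotes x p) :
    ∃ B, dnf s = [B] ∧ DenotesList (conjuncts s) B := by
  have key : ∀ s : Ty A, (∀ x ∈ infs s, ∃ p, Denotes x p) →
      ∃ B, dnf s = [B] ∧ DenotesList (infs s) B := by
    intro s
    induction s with
    | inf s t hs ht =>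
      intro h
      simp only [infs, List.mem_append] at h
      obtain ⟨B, hB, hsB⟩ := hs fun x hx => h x (.inl hx)
      obtain ⟨B', hB', htB'⟩ := ht fun x hx => h x (.inr hx)
      exact ⟨B ++ B', by simp [dnf, hB, hB'], hsB.append htB'⟩
    | _ =>
      intro h
      obtain ⟨p, hp⟩ := h _ (List.mem_singleton_self _)
      exact ⟨[p], hp.2, denotesList_singleton hp⟩
  cases s with
  | omega => exact ⟨[], by simp [dnf], by simp [DenotesList, conjuncts]⟩
  | _ => exact key _ h

theorem exists_cnf_eq {s : Ty A} (h : ∀ x ∈ sups s, ∃ p, Denotes x p) :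
    ∃ B, cnf s = [B] ∧ DenotesList (sups s) B := by
  induction s with
  | sup s t hs ht =>
    simp only [sups, List.mem_append] at h
    obtain ⟨B, hB, hsB⟩ := hs fun x hx => h x (.inl hx)
    obtain ⟨B', hB', htB'⟩ := ht fun x hx => h x (.inr hx)
    exact ⟨B ++ B', by simp [cnf, hB, hB'], hsB.append htB'⟩
  | _ =>
    obtain ⟨p, hp⟩ := h _ (List.mem_singleton_self _)
    exact ⟨[p], hp.1, denotesList_singleton hp⟩

theorem denotes_atom (a : A) : Denotes (.atom a) (.atom a) := by simp [Denotes, cnf, dnf]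

theorem denotes_arr {s t : Ty A} {B D : List (PTy A)} (hs : dnf s = [B]) (ht : cnf t = [D]) :
    Denotes (s ⟶ₜ t) (.arr B D) := by
  simp [Denotes, cnf, dnf, hs, ht]

theorem exists_denotes {x : Ty A} (hb : Base x) (h : INormal x) : ∃ p, Denotes x p := by
  induction hn : sizeOf x using Nat.strong_induction_on generalizing x with
  | _ n ih =>
    subst hn
    cases x with
    | atom a => exact ⟨_, denotes_atom a⟩
    | arr s t =>
      obtain ⟨B, hB, -⟩ := exists_dnf_eq (s := s) fun x hx =>
        ih _ (by have := sizeOf_le_of_mem_conjuncts hx; simp; omega)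
          (h.base_of_mem_conjuncts hx) (h.of_arr_left.of_mem_conjuncts hx) rfl
      obtain ⟨D, hD, -⟩ := exists_cnf_eq (s := t) fun x hx =>
        ih _ (by have := sizeOf_le_of_mem_sups hx; simp; omega)
          (h.base_of_mem_sups hx) (h.of_arr_right.of_mem_sups hx) rfl
      exact ⟨_, denotes_arr hB hD⟩
    | omega | inf | sup => exact False.elim hb

theorem Denotes.rLe_iff {x y : Ty A} {p q : PTy A} (hx : Denotes x p) (hy : Denotes y q) :
    RLe x y ↔ PLe p q := by
  simp [RLe, UnionLe, hx.1, hy.1]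

/-- A normal atom or arrow. -/
def NBase (x : Ty A) : Prop := Base x ∧ INormal x

/-- A normal union of atoms and arrows. -/
def NUnion (s : Ty A) : Prop := INormal s ∧ ∀ x ∈ sups s, Base x

theorem NBase.mem_conjuncts {s t x : Ty A} (h : NBase (s ⟶ₜ t)) (hx : x ∈ conjuncts s) :
    NBase x :=
  ⟨h.2.base_of_mem_conjuncts hx, h.2.of_arr_left.of_mem_conjuncts hx⟩

theorem NBase.nUnion {s t : Ty A} (h : NBase (s ⟶ₜ t)) : NUnion t :=
  ⟨h.2.of_arr_right, fun _ hx => h.2.base_of_mem_sups hx⟩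

theorem NUnion.mem_sups {s x : Ty A} (h : NUnion s) (hx : x ∈ sups s) : NBase x :=
  ⟨h.2 x hx, h.1.of_mem_sups hx⟩

theorem NUnion.exists_cnf_eq {s : Ty A} (h : NUnion s) :
    ∃ B, cnf s = [B] ∧ DenotesList (sups s) B :=
  IUType.exists_cnf_eq fun _ hx => exists_denotes (h.mem_sups hx).1 (h.mem_sups hx).2

theorem NBase.exists_dnf_eq {s t : Ty A} (h : NBase (s ⟶ₜ t)) :
    ∃ B, dnf s = [B] ∧ DenotesList (conjuncts s) B :=
  IUType.exists_dnf_eq fun _ hx => exists_denotes (h.mem_conjuncts hx).1 (h.mem_conjuncts hx).2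

theorem NUnion.rLe_sups {s t x : Ty A} (hs : NUnion s) (ht : NUnion t) (h : RLe s t)
    (hx : x ∈ sups s) : ∃ y ∈ sups t, RLe x y := by
  obtain ⟨B, hB, hsB⟩ := hs.exists_cnf_eq
  obtain ⟨D, hD, htD⟩ := ht.exists_cnf_eq
  have hBD : UnionLe B D := by simpa [RLe, hB, hD] using h
  obtain ⟨p, hp, hxp⟩ := hsB.1 x hx
  obtain ⟨q, hq, hpq⟩ := hBD p hp
  obtain ⟨y, hy, hyq⟩ := htD.2 q hq
  exact ⟨y, hy, (hxp.rLe_iff hyq).2 hpq⟩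

theorem NBase.rLe_arr_arr {s t s' t' : Ty A} (h : NBase (s ⟶ₜ t)) (h' : NBase (s' ⟶ₜ t'))
    (hle : RLe (s ⟶ₜ t) (s' ⟶ₜ t')) :
    (∀ x ∈ conjuncts s, ∃ y ∈ conjuncts s', RLe y x) ∧ RLe t t' := by
  obtain ⟨B, hB, hsB⟩ := h.exists_dnf_eq
  obtain ⟨B', hB', hsB'⟩ := h'.exists_dnf_eq
  obtain ⟨D, hD, -⟩ := h.nUnion.exists_cnf_eq
  obtain ⟨D', hD', -⟩ := h'.nUnion.exists_cnf_eq
  obtain ⟨h₁, h₂⟩ :=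
    pLe_arr_arr.1 (((denotes_arr hB hD).rLe_iff (denotes_arr hB' hD')).1 hle)
  refine ⟨fun x hx => ?_, by simpa [RLe, hD, hD'] using h₂⟩
  obtain ⟨p, hp, hxp⟩ := hsB.1 x hx
  obtain ⟨q, hq, hqp⟩ := h₁ p hp
  obtain ⟨y, hy, hyq⟩ := hsB'.2 q hq
  exact ⟨y, hy, (hyq.rLe_iff hxp).2 hqp⟩

theorem NBase.rLe_atom_arr {a : A} {s t : Ty A} (h : NBase (s ⟶ₜ t))
    (hle : RLe (.atom a) (s ⟶ₜ t)) : ∃ y ∈ sups t, RLe (.atom a) y := by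
  obtain ⟨B, hB, -⟩ := h.exists_dnf_eq
  obtain ⟨D, hD, htD⟩ := h.nUnion.exists_cnf_eq
  cases ((denotes_atom a).rLe_iff (denotes_arr hB hD)).1 hle with
  | atom_arr hb hab =>
    obtain ⟨y, hy, hyb⟩ := htD.2 _ hb
    exact ⟨y, hy, ((denotes_atom a).rLe_iff hyb).2 hab⟩

theorem NBase.rLe_arr_atom {a : A} {s t : Ty A} (h : NBase (s ⟶ₜ t))
    (hle : RLe (s ⟶ₜ t) (.atom a)) : s = .omega ∧ ∀ y ∈ sups t, RLe y (.atom a) := by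
  obtain ⟨B, hB, hsB⟩ := h.exists_dnf_eq
  obtain ⟨D, hD, htD⟩ := h.nUnion.exists_cnf_eq
  cases ((denotes_arr hB hD).rLe_iff (denotes_atom a)).1 hle with
  | arr_atom hb =>
    constructor
    · refine conjuncts_eq_nil (List.eq_nil_iff_forall_not_mem.2 fun x hx => ?_)
      obtain ⟨p, hp, -⟩ := hsB.1 x hx
      simp at hp
    · intro y hy
      obtain ⟨q, hq, hyq⟩ := htD.1 y hy
      exact (hyq.rLe_iff (denotes_atom a)).2 (hb q hq)

theorem rLe_atom_atom {a b : A} (h : RLe (Ty.atom a) (.atom b)) : a = b := by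
  cases ((denotes_atom a).rLe_iff (denotes_atom b)).1 h
  rfl

/-! ### Equivalent normal types are equal -/

/-- An arrow below an atom `a` is equivalent to `ω → a`, which is not normal. -/
theorem NBase.eq_atom {x : Ty A} {a : A} (h : NBase x) (hle : RLe x (.atom a)) : x = .atom a := by
  induction hn : sizeOf x using Nat.strong_induction_on generalizing x with
  | _ n ih =>
    subst hn
    obtain ⟨hb, hx⟩ := h
    cases x with
    | atom b => rw [rLe_atom_atom hle]
    | arr s t =>
      exfalso
      obtain ⟨rfl, ht⟩ := NBase.rLe_arr_atom ⟨hb, hx⟩ hle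
      have hu : NUnion t := NBase.nUnion ⟨hb, hx⟩
      have hall (y : Ty A) (hy : y ∈ sups t) : y = .atom a :=
        ih _ (by have := sizeOf_le_of_mem_sups hy; simp; omega) (hu.mem_sups hy) (ht y hy) rfl
      obtain rfl := eq_of_sups_eq_singleton
        (hu.1.irredundant_sups.eq_singleton_of_forall (sups_ne_nil t) hall)
      exact hx.not_inner (.atom a)
    | omega | inf | sup => exact False.elim hb

theorem NUnion.nLe_of_rLe {s t : Ty A} (hs : NUnion s) (ht : NUnion t) (h : RLe s t)
    (hle : ∀ x ∈ sups s, ∀ y ∈ sups t, RLe x y → NLe x y) : NLe s t :=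
  nLe_of_forall_sups fun x hx =>
    let ⟨y, hy, hxy⟩ := hs.rLe_sups ht h hx
    (hle x hx y hy hxy).trans (nLe_of_mem_sups hy)

/-- On normal atoms and arrows the induced order is contained in the normalisation pre-order. -/
theorem NBase.nLe_of_rLe {x y : Ty A} (hx : NBase x) (hy : NBase y) (h : RLe x y) : NLe x y := by
  induction hn : sizeOf x + sizeOf y using Nat.strong_induction_on generalizing x y with
  | _ n ih =>
    subst hn
    cases y with
    | atom a =>
      rw [hx.eq_atom h]
      exact .refl _
    | arr s' t' =>
      cases x with
      | atom a =>
        obtain ⟨y, hyt, hay⟩ := hy.rLe_atom_arr h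
        have hay' := ih _ (by have := sizeOf_le_of_mem_sups hyt; simp; omega) hx
          (hy.nUnion.mem_sups hyt) hay rfl
        exact (NLe.atom_arr a s').trans (.arr_mono (.refl _) (hay'.trans (nLe_of_mem_sups hyt)))
      | arr s t =>
        obtain ⟨h₁, h₂⟩ := hx.rLe_arr_arr hy h
        refine .arr_mono (nLe_of_forall_conjuncts fun z hz => ?_)
          (hx.nUnion.nLe_of_rLe hy.nUnion h₂ fun z hz w hw hzw => ?_)
        · obtain ⟨w, hw, hwz⟩ := h₁ z hz
          refine (nLe_of_mem_conjuncts hw).trans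
            (ih _ ?_ (hy.mem_conjuncts hw) (hx.mem_conjuncts hz) hwz rfl)
          have := sizeOf_le_of_mem_conjuncts hz
          have := sizeOf_le_of_mem_conjuncts hw
          simp; omega
        · refine ih _ ?_ (hx.nUnion.mem_sups hz) (hy.nUnion.mem_sups hw) hzw rfl
          have := sizeOf_le_of_mem_sups hz
          have := sizeOf_le_of_mem_sups hw
          simp; omega
      | omega | inf | sup => exact False.elim hx.1
    | omega | inf | sup => exact False.elim hy.1

theorem NUnion.nLe {s t : Ty A} (hs : NUnion s) (ht : NUnion t) (h : RLe s t) : NLe s t :=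
  hs.nLe_of_rLe ht h fun _ hx _ hy => (hs.mem_sups hx).nLe_of_rLe (ht.mem_sups hy)

theorem NUnion.acEq_of_rLe {s t : Ty A} (hs : NUnion s) (ht : NUnion t) (h₁ : RLe s t)
    (h₂ : RLe t s) (hac : ∀ x ∈ sups s, ∀ y ∈ sups t, RLe x y → RLe y x → ACEq x y) :
    ACEq s t := by
  have hR {s : Ty A} (hs : NUnion s) : ∀ x ∈ sups s, ∀ y ∈ sups s, RLe x y → x = y :=
    fun x hx y hy h =>
      hs.1.irredundant_sups.2 x hx y hy ((hs.mem_sups hx).nLe_of_rLe (hs.mem_sups hy) h)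
  refine (acEq_big_sups s).trans (ACEq.trans ?_ (acEq_big_sups t).symm)
  exact acOp_sup.big_acEq_of_rel hs.1.irredundant_sups ht.1.irredundant_sups
    (R := RLe) RLe.trans (hR hs) (hR ht) (fun _ hx => hs.rLe_sups ht h₁ hx) (fun _ hx => ht.rLe_sups hs h₂ hx) hac

theorem NBase.acEq_of_rLe {x y : Ty A} (hx : NBase x) (hy : NBase y) (h₁ : RLe x y)
    (h₂ : RLe y x) : ACEq x y := by
  induction hn : sizeOf x + sizeOf y using Nat.strong_induction_on generalizing x y with
  | _ n ih =>
    subst hn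
    cases y with
    | atom a =>
      rw [hx.eq_atom h₁]
      exact .refl _
    | arr s' t' =>
      cases x with
      | atom a =>
        rw [hy.eq_atom h₂]
        exact .refl _
      | arr s t =>
        obtain ⟨hs, ht⟩ := hx.rLe_arr_arr hy h₁
        obtain ⟨hs', ht'⟩ := hy.rLe_arr_arr hx h₂
        refine .arr ?_ (hx.nUnion.acEq_of_rLe hy.nUnion ht ht' fun z hz w hw => ?_)
        · have hR {s t : Ty A} (h : NBase (s ⟶ₜ t)) :
              ∀ z ∈ conjuncts s, ∀ w ∈ conjuncts s, RLe w z → z = w := fun z hz w hw hwz =>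
            (h.2.of_arr_left.irredundant_conjuncts.2 w hw z hz
              ((h.mem_conjuncts hw).nLe_of_rLe (h.mem_conjuncts hz) hwz)).symm
          refine (acEq_big_conjuncts s).trans (ACEq.trans ?_ (acEq_big_conjuncts s').symm)
          refine acOp_inf.big_acEq_of_rel hx.2.of_arr_left.irredundant_conjuncts
            hy.2.of_arr_left.irredundant_conjuncts (R := fun z w => RLe w z)
            (fun h h' => RLe.trans h' h) (hR hx) (hR hy) hs hs' fun z hz w hw hwz hzw => ?_
          refine ih _ ?_ (hx.mem_conjuncts hz) (hy.mem_conjuncts hw) hzw hwz rfl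
          have := sizeOf_le_of_mem_conjuncts hz
          have := sizeOf_le_of_mem_conjuncts hw
          simp; omega
        · intro hzw hwz
          refine ih _ ?_ (hx.nUnion.mem_sups hz) (hy.nUnion.mem_sups hw) hzw hwz rfl
          have := sizeOf_le_of_mem_sups hz
          have := sizeOf_le_of_mem_sups hw
          simp; omega
      | omega | inf | sup => exact False.elim hx.1
    | omega | inf | sup => exact False.elim hy.1

theorem NUnion.acEq {s t : Ty A} (hs : NUnion s) (ht : NUnion t) (h₁ : RLe s t) (h₂ : RLe t s) :
    ACEq s t :=
  hs.acEq_of_rLe ht h₁ h₂ fun _ hx _ hy => (hs.mem_sups hx).acEq_of_rLe (ht.mem_sups hy)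

/-- A normal type is an intersection of normal unions of atoms and arrows. -/
theorem IsNormal.nUnion {s c : Ty A} (h : IsNormal (TyAC.mk s)) (hc : c ∈ conjuncts s) :
    NUnion c := by
  have hN := h.iNormal.of_mem_conjuncts hc
  refine ⟨hN, fun x hx => base_of_ne
    (hN.ne_omega_of_mem_sups (h.iNormal.ne_omega_of_mem_conjuncts hc) hx) ?_
    (ne_sup_of_mem_sups hx)⟩
  rintro a b rfl
  have hc' := mem_infs_of_mem_conjuncts hc
  obtain rfl | ⟨z, hz⟩ := eq_or_acEq_of_mem_sups hx
  · exact ne_inf_of_mem_infs hc' a b rfl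
  · -- The union `c` contains the intersection of `a` and `b`, and it lies at top level in `s`.
    obtain rfl | ⟨w, hw⟩ := eq_or_acEq_of_mem_infs hc'
    · exact h _ ⟨_, _, mk_eq_mk.2 hz.symm, rfl, .dist .hole a b z trivial⟩
    · exact h _ ⟨_, _, mk_eq_mk.2 (hw.trans (.inf hz (.refl w))).symm, rfl,
        .dist (.infLeft .hole w) a b z trivial⟩

theorem mem_cnf_iff {s : Ty A} {D : List (PTy A)} :
    D ∈ cnf s ↔ ∃ c ∈ conjuncts s, D ∈ cnf c := by
  have key : ∀ s : Ty A, D ∈ cnf s ↔ ∃ c ∈ infs s, D ∈ cnf c := by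
    intro s
    induction s with
    | inf s t hs ht => simp only [cnf, infs, List.mem_append, hs, ht, or_and_right, exists_or]
    | _ => simp [infs]
  cases s with
  | omega => simp [cnf, conjuncts]
  | _ => exact key _

theorem IsNormal.rLe_conjuncts {s t d : Ty A} (ht : IsNormal (TyAC.mk t)) (h : RLe s t)
    (hd : d ∈ conjuncts t) : ∃ c ∈ conjuncts s, RLe c d := by
  obtain ⟨D, hD, -⟩ := (ht.nUnion hd).exists_cnf_eq
  obtain ⟨C, hC, hCD⟩ := h D (mem_cnf_iff.2 ⟨d, hd, by simp [hD]⟩)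
  obtain ⟨c, hc, hCc⟩ := mem_cnf_iff.1 hC
  refine ⟨c, hc, ?_⟩
  intro D' hD'
  rw [hD, List.mem_singleton] at hD'
  exact ⟨C, hCc, hD' ▸ hCD⟩

theorem IsNormal.acEq {s t : Ty A} (hs : IsNormal (TyAC.mk s)) (ht : IsNormal (TyAC.mk t))
    (h₁ : RLe s t) (h₂ : RLe t s) : ACEq s t := by
  have hR {s : Ty A} (h : IsNormal (TyAC.mk s)) :
      ∀ c ∈ conjuncts s, ∀ d ∈ conjuncts s, RLe d c → c = d := fun c hc d hd hdc =>
    (h.iNormal.irredundant_conjuncts.2 d hd c hc ((h.nUnion hd).nLe (h.nUnion hc) hdc)).symm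
  refine (acEq_big_conjuncts s).trans (ACEq.trans ?_ (acEq_big_conjuncts t).symm)
  exact acOp_inf.big_acEq_of_rel hs.iNormal.irredundant_conjuncts ht.iNormal.irredundant_conjuncts
    (R := fun c d => RLe d c) (fun h h' => RLe.trans h' h) (hR hs) (hR ht)
    (fun _ hc => hs.rLe_conjuncts h₂ hc) (fun _ hd => ht.rLe_conjuncts h₁ hd)
    fun c hc d hd hdc hcd => (hs.nUnion hc).acEq (ht.nUnion hd) hcd hdc

/-! ### Existence and uniqueness of normal forms -/

theorem exists_normal (p : TyAC A) : ∃ n, Steps p n ∧ IsNormal n := by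
  induction p using (terminating A).induction with
  | _ p ih =>
    by_cases h : IsNormal p
    · exact ⟨p, .refl, h⟩
    · obtain ⟨q, hq⟩ := not_forall_not.1 h
      obtain ⟨n, hn, hN⟩ := ih q hq
      exact ⟨n, .head hq hn, hN⟩

theorem normal_unique {p m n : TyAC A} (hm : Steps p m) (hn : Steps p n) (hm' : IsNormal m)
    (hn' : IsNormal n) : m = n := by
  induction p using Quotient.inductionOn with | _ s
  induction m using Quotient.inductionOn with | _ t
  induction n using Quotient.inductionOn with | _ r
  have h₁ := hm.rLe s t rfl rfl
  have h₂ := hn.rLe s r rfl rfl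
  exact mk_eq_mk.2 (IsNormal.acEq hm' hn' (h₁.2.trans h₂.1) (h₂.2.trans h₁.1))

end IUType

theorem mainTheorem3 (A : Type*) :
    IUType.Terminating A ∧ IUType.Confluent A ∧
      ∀ s : IUType.Ty A, ∃! n : IUType.TyAC A,
        IUType.Steps (IUType.TyAC.mk s) n ∧ IUType.IsNormal n := by
  refine ⟨IUType.terminating A, fun p q r hq hr => ?_, fun s => ?_⟩
  · obtain ⟨m, hm, hm'⟩ := IUType.exists_normal q
    obtain ⟨n, hn, hn'⟩ := IUType.exists_normal r
    obtain rfl := IUType.normal_unique (Relation.ReflTransGen.trans hq hm)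
      (Relation.ReflTransGen.trans hr hn) hm' hn'
    exact ⟨m, hm, hn⟩
  · obtain ⟨n, hn, hn'⟩ := IUType.exists_normal (IUType.TyAC.mk s)
    exact ⟨n, ⟨hn, hn'⟩, fun m hm => IUType.normal_unique hm.1 hn hm.2 hn'⟩
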